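/- For graphs $H_1,\dots,H_s$, the multicolor Ramsey number $r(H_1,\dots,H_s)$ is the minimum integer $r$ such that every coloring of the edges of the complete graph $K_r$ with $s$ colors contains, for some $1\le i\le s$, a copy of $H_i$ all of whose edges have color $i$. For $k\ge 1$ write $r_k(H;G)=r(H,\dots,H,G)$, where $H$ is repeated $k$ times. Let $K_m$ be the complete graph on $m$ vertices and $K_{2,t}$ the complete bipartite graph with parts of sizes $2$ and $t$; $\log$ is the natural logarithm. For every integer $k\ge 3$ there is a constant $\rho>0$, depending only on $k$, such that for all integers $t\ge 2$ and $m$: (i) if $m\ge 128(\log t)^2$, then $\displaystyle r(K_{2,t},K_{2,t},K_m)\ \ge\ \rho\,\frac{m^2t}{(\log(mt))^4}$; (ii) if $m\ge 16k\log t$, then $\displaystyle r_k(K_{2,t};K_m)\ \ge\ \rho\,\frac{m^2t}{(\log(mt))^2}$. -/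

import Mathlib

/-- `r` has the Ramsey property for the family of graphs `H i`, indexed by the colors `i : ι`:
every coloring of the edges of the complete graph on `r` vertices by `ι` has, for some color `i`,
a (not necessarily induced) copy of `H i` all of whose edges have color `i`. -/
def RamseyProperty {ι : Type*} {V : ι → Type*} (H : (i : ι) → SimpleGraph (V i)) (r : ℕ) : Prop :=
  ∀ c : SimpleGraph.TopEdgeLabeling (Fin r) ι, ∃ i : ι, (H i).IsContained (c.labelGraph i)

/-- The multicolor Ramsey number of the family of graphs `H i`, indexed by the colors `i : ι`. -/
noncomputable def multicolorRamsey {ι : Type*} {V : ι → Type*}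
    (H : (i : ι) → SimpleGraph (V i)) : ℕ :=
  sInf {r : ℕ | RamseyProperty H r}

/-- The family `H, …, H, G` with `H` repeated `k` times, indexed by `Fin k ⊕ Unit`
(`k + 1` colors). -/
def repeatThen (k : ℕ) {V W : Type} (H : SimpleGraph V) (G : SimpleGraph W) :
    (i : Fin k ⊕ Unit) → SimpleGraph (Sum.elim (fun _ => V) (fun _ => W) i)
  | Sum.inl _ => H
  | Sum.inr _ => G

/-- `r_k(H; G) = r(H, …, H, G)`, with `H` repeated `k` times. -/
noncomputable def ramseyRep (k : ℕ) {V W : Type} (H : SimpleGraph V) (G : SimpleGraph W) : ℕ :=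
  multicolorRamsey (repeatThen k H G)

/-- The complete bipartite graph `K_{s,t}`. -/
abbrev bipartiteK (s t : ℕ) : SimpleGraph (Fin s ⊕ Fin t) :=
  completeBipartiteGraph (Fin s) (Fin t)

/-- The complete graph `K_m`. -/
abbrev completeK (m : ℕ) : SimpleGraph (Fin m) := SimpleGraph.completeGraph (Fin m)

/-! A `q`-regular graph on `n = q² / T` vertices, any two of which have at most `T < t` common
neighbours, contains no `K_{2,t}`. It is given by `v₂ + u₂ = φ(v₁u₁)` on `F × W`, with `φ : F → W`
additive and onto, with fibres of size `T`.

Its degrees into any set `U` have small variance, so few vertices have at most half the average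
degree into `U`. Build an independent `m`-set vertex by vertex, `U` being the set of candidates
left: a typical choice shrinks `U` by a factor `1 - T/(2q)`, which can happen only about `(q/T) log
n` times, and any other choice is among at most `L ≈ q^(3/2)/T` vertices. This bounds the number `I`
of independent `m`-sets (`factorial_mul_card_independentSets_le`).

Place `l` copies of the graph by random permutations of the vertices. The expected number of
`m`-sets independent in every copy is `C(n,m) (I / C(n,m))^l`; if it is below 1, colouring by the
copies, with the last colour for the remaining pairs, avoids `K_m`. With `l = 2` this needs `m` of
order `(q/T) log²`; with `l = 3` there is slack, and order `(q/T) log` suffices. Taking `T` close to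
`t` gives `n` of order `t(q/T)²`, the claimed bounds. -/

/-! ### Finiteness of multicolor Ramsey numbers -/

open Finset in
theorem exists_monochromatic_clique {ι : Type*} [Fintype ι] [DecidableEq ι] (a : ι → ℕ) :
    ∃ r : ℕ, ∀ {V : Type} [DecidableEq V] (c : V → V → ι), (∀ x y, c x y = c y x) →
      ∀ s : Finset V, r ≤ #s → ∃ i, ∃ u ⊆ s, #u = a i ∧ ∀ x ∈ u, ∀ y ∈ u, x ≠ y → c x y = i := by
  induction hN : ∑ i, a i generalizing a with
  | zero =>
    rcases isEmpty_or_nonempty ι with hι | ⟨⟨i⟩⟩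
    · refine ⟨1, fun c _ s hs => ?_⟩
      obtain ⟨v, -⟩ := card_pos.1 hs
      exact (hι.false (c v v)).elim
    · refine ⟨0, fun c _ s _ => ⟨i, ∅, empty_subset _, ?_, by simp⟩⟩
      rw [card_empty]
      exact ((sum_eq_zero_iff.1 hN) i (mem_univ i)).symm
  | succ N ih =>
    by_cases h0 : ∃ i, a i = 0
    · obtain ⟨i, hi⟩ := h0
      exact ⟨0, fun c _ s _ => ⟨i, ∅, empty_subset _, by simp [hi], by simp⟩⟩
    push Not at h0
    have key : ∀ i, ∃ r : ℕ, ∀ {V : Type} [DecidableEq V] (c : V → V → ι),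
        (∀ x y, c x y = c y x) → ∀ s : Finset V, r ≤ #s →
        ∃ j, ∃ u ⊆ s, #u = Function.update a i (a i - 1) j ∧
          ∀ x ∈ u, ∀ y ∈ u, x ≠ y → c x y = j := by
      intro i
      apply ih
      have h1 := Finset.sum_update_of_mem (mem_univ i) a (a i - 1)
      have h2 := Finset.add_sum_erase univ a (mem_univ i)
      rw [← Finset.erase_eq] at h1
      have := h0 i
      omega
    choose R hR using key
    -- Pigeonhole on the colours at a vertex `v`: some class has at least `R i` elements, and `v`
    -- extends a clique of colour `i` found inside it.
    refine ⟨1 + ∑ i, R i, fun {V} _ c hc s hs => ?_⟩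
    obtain ⟨v, hv⟩ : s.Nonempty := card_pos.1 (by omega)
    have hcard : ∑ i, #((s.erase v).filter (fun x => c v x = i)) = #(s.erase v) :=
      (card_eq_sum_card_fiberwise (fun _ _ => mem_univ _)).symm
    obtain ⟨i, -, hi⟩ : ∃ i ∈ univ, R i ≤ #((s.erase v).filter (fun x => c v x = i)) := by
      by_contra! hlt
      rcases isEmpty_or_nonempty ι with hι | hι
      · exact hι.false (c v v)
      · have := sum_lt_sum_of_nonempty univ_nonempty hlt
        rw [hcard, card_erase_of_mem hv] at this
        omega
    obtain ⟨j, u, hu, huc, hum⟩ := hR i c hc _ hi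
    have hus : u ⊆ s := fun x hx => mem_of_mem_erase (mem_filter.1 (hu hx)).1
    by_cases hj : j = i
    · subst hj
      have hvu : v ∉ u := fun h => by simpa using hu h
      refine ⟨j, insert v u, insert_subset hv hus, ?_, ?_⟩
      · have := h0 j
        rw [card_insert_of_notMem hvu, huc, Function.update_self]
        omega
      · intro x hx y hy hxy
        rcases mem_insert.1 hx with rfl | hx'
        · rcases mem_insert.1 hy with rfl | hy'
          · exact absurd rfl hxy
          · exact (mem_filter.1 (hu hy')).2
        · rcases mem_insert.1 hy with rfl | hy'
          · rw [hc]; exact (mem_filter.1 (hu hx')).2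
          · exact hum x hx' y hy' hxy
    · exact ⟨j, u, hus, by rw [huc, Function.update_of_ne hj], hum⟩

-- Without this, `sInf` could be taken over the empty set and return `0`, which no lower bound
-- survives.
open Finset in
theorem exists_ramseyProperty {ι : Type*} [Finite ι] {V : ι → Type*} [∀ i, Finite (V i)]
    (H : (i : ι) → SimpleGraph (V i)) : ∃ r, RamseyProperty H r := by
  classical
  have := Fintype.ofFinite ι
  obtain ⟨r, hr⟩ := exists_monochromatic_clique (fun i : ι => Nat.card (V i))
  rcases isEmpty_or_nonempty ι with hι | ⟨⟨i₀⟩⟩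
  · refine ⟨2, fun c => (hι.false (c.get 0 1 (by simp))).elim⟩
  refine ⟨r, fun c => ?_⟩
  obtain ⟨i, u, -, huc, hu⟩ := hr (V := Fin r)
    (fun x y => if h : x ≠ y then c.get x y h else i₀)
    (fun x y => by
      by_cases h : x = y
      · simp [h]
      · simp only [ne_eq, h, not_false_eq_true, dite_true, Ne.symm h]
        exact c.get_comm _ _ _) univ (by simp)
  refine ⟨i, ?_⟩
  have := Fintype.ofFinite (V i)
  have e : V i ≃ u := Fintype.equivOfCardEq (by rw [Fintype.card_coe, huc, Nat.card_eq_fintype_card])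
  refine ⟨⟨⟨fun x => (e x : Fin r), ?_⟩, ?_⟩⟩
  · intro x y hxy
    have hne : (e x : Fin r) ≠ e y := fun h => hxy.ne (e.injective (Subtype.ext h))
    rw [SimpleGraph.TopEdgeLabeling.labelGraph_adj]
    refine ⟨hne, ?_⟩
    simpa [hne] using hu _ (e x).2 _ (e y).2 hne
  · intro x y h
    exact e.injective (Subtype.ext h)

/-! ### From graphs to lower bounds for Ramsey numbers -/

open Classical in
/-- The first color `i` with `P i`, if there is one, and the last color otherwise. -/
noncomputable def colorOf {k : ℕ} (P : Fin k → Prop) : Fin k ⊕ Unit :=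
  if h : ∃ i, P i then Sum.inl h.choose else Sum.inr ()

theorem colorOf_inl {k : ℕ} {P : Fin k → Prop} {i : Fin k} (h : colorOf P = Sum.inl i) : P i := by
  unfold colorOf at h
  split_ifs at h with h'
  · have := h'.choose_spec
    rw [Sum.inl.injEq] at h
    rwa [h] at this

theorem colorOf_inr {k : ℕ} {P : Fin k → Prop} {i : Unit} (h : colorOf P = Sum.inr i) (j : Fin k) :
    ¬ P j := by
  unfold colorOf at h
  split_ifs at h with h'
  exact fun hj => h' ⟨j, hj⟩

/-- Each pair gets some colour `i` for which it is an edge of `G i`, and the last colour if there is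
none. Colour classes are then subgraphs of the `G i`, and a clique in the last colour is independent
in all of them. -/
theorem card_lt_of_ramseyProperty {k m r : ℕ} {V W : Type} [Fintype V] {H : SimpleGraph W}
    (hr : RamseyProperty (repeatThen k H (completeK m)) r) (G : Fin k → SimpleGraph V)
    (hG : ∀ i, H.Free (G i))
    (hind : ∀ S : Finset V, S.card = m → ∃ i, ∃ x ∈ S, ∃ y ∈ S, (G i).Adj x y) :
    Fintype.card V < r := by
  classical
  by_contra! hle
  obtain ⟨f⟩ : Nonempty (Fin r ↪ V) := Function.Embedding.nonempty_of_card_le (by simpa using hle)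
  obtain ⟨i, ⟨g⟩⟩ := hr (SimpleGraph.EdgeLabeling.mk
    (fun x y _ => colorOf fun i => (G i).Adj (f x) (f y))
    (fun x y _ => by simp only [SimpleGraph.adj_comm]))
  rcases i with i | i
  · refine hG i ⟨⟨⟨fun x => f (g x), ?_⟩, ?_⟩⟩
    · intro a b hab
      obtain ⟨hne, h⟩ := (SimpleGraph.TopEdgeLabeling.labelGraph_adj _ _).1 (g.toHom.map_adj hab)
      exact colorOf_inl (P := fun i => (G i).Adj (f (g a)) (f (g b))) h
    · exact f.injective.comp g.injective
  · let e : Fin m ↪ V := ⟨fun x => f (g x), f.injective.comp g.injective⟩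
    obtain ⟨j, x, hx, y, hy, hxy⟩ := hind (Finset.univ.map e) (by simp)
    obtain ⟨a, -, rfl⟩ := Finset.mem_map.1 hx
    obtain ⟨b, -, rfl⟩ := Finset.mem_map.1 hy
    have hab : (repeatThen k H (completeK m) (Sum.inr i)).Adj a b := by
      change a ≠ b
      rintro rfl
      exact (G j).loopless.irrefl _ hxy
    obtain ⟨hne, h⟩ := (SimpleGraph.TopEdgeLabeling.labelGraph_adj _ _).1 (g.toHom.map_adj hab)
    exact colorOf_inr (P := fun i => (G i).Adj (f (g a)) (f (g b))) h j hxy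

theorem card_lt_ramseyRep {k m : ℕ} {V W : Type} [Fintype V] [Finite W] {H : SimpleGraph W}
    (G : Fin k → SimpleGraph V) (hG : ∀ i, H.Free (G i))
    (hind : ∀ S : Finset V, S.card = m → ∃ i, ∃ x ∈ S, ∃ y ∈ S, (G i).Adj x y) :
    Fintype.card V < ramseyRep k H (completeK m) := by
  have (i : Fin k ⊕ Unit) : Finite (Sum.elim (fun _ => W) (fun _ => Fin m) i) := by
    rcases i with i | i
    · exact ‹Finite W›
    · exact inferInstanceAs (Finite (Fin m))
  exact card_lt_of_ramseyProperty
    (Nat.sInf_mem (exists_ramseyProperty (repeatThen k H (completeK m)))) G hG hind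

/-- `K_{2,t}` has `t + 2` vertices, so even a complete graph on `t + 1` avoids it. This covers the
range where `m` is too small for the random construction. -/
theorem lt_ramseyRep_bipartiteK (k t m : ℕ) (hk : 0 < k) (hm : 2 ≤ m) :
    t + 1 < ramseyRep k (bipartiteK 2 t) (completeK m) := by
  have := card_lt_ramseyRep (k := k) (m := m) (V := Fin (t + 1)) (H := bipartiteK 2 t)
    (fun _ => ⊤) (fun _ ⟨g⟩ => by
      have := Fintype.card_le_of_injective g g.injective
      simp at this
      omega) (fun S hS => by
      obtain ⟨x, hx, y, hy, hxy⟩ := Finset.one_lt_card.1 (by omega : 1 < S.card)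
      exact ⟨⟨0, hk⟩, x, hx, y, hy, hxy⟩)
  simpa using this

theorem le_ramseyRep_bipartiteK (k t m : ℕ) (ht : 0 < t) :
    m ≤ ramseyRep k (bipartiteK 2 t) (completeK m) := by
  have := card_lt_ramseyRep (k := k) (m := m) (V := Fin (m - 1)) (H := bipartiteK 2 t)
    (fun _ => ⊥) (fun _ ⟨g⟩ => by
      have h : (bipartiteK 2 t).Adj (Sum.inl 0) (Sum.inr ⟨0, ht⟩) := by simp [bipartiteK]
      exact g.toHom.map_adj h)
  rcases Nat.eq_zero_or_pos m with rfl | hm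
  · simp
  have := this (fun S hS => by
    have := S.card_le_univ
    simp at this
    omega)
  rw [Fintype.card_fin] at this
  omega

/-! ### Degrees into a set: the second moment -/

open Finset

/-- `N v` is the set of neighbors of `v` in a graph, possibly with loops, that is `q`-regular and
in which any two different vertices have at most `T` common neighbors; the number of vertices is the
one for which this bound is attained on average. -/
structure IsNeighborhoodDesign {V : Type*} [Fintype V] [DecidableEq V] (N : V → Finset V)
    (q T : ℕ) : Prop where
  symm : ∀ u v, u ∈ N v → v ∈ N u
  card_eq : ∀ v, #(N v) = q
  card_inter_le : ∀ u v, u ≠ v → #(N u ∩ N v) ≤ T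
  card_mul : Fintype.card V * T = q ^ 2
  pos : 0 < T
  le : T ≤ q

namespace IsNeighborhoodDesign

variable {V : Type*} [Fintype V] [DecidableEq V] {N : V → Finset V} {q T : ℕ}

theorem card_pos (h : IsNeighborhoodDesign N q T) : 0 < Fintype.card V := by
  have h2 : 0 < q ^ 2 := Nat.pow_pos (h.pos.trans_le h.le)
  rw [← h.card_mul] at h2
  exact Nat.pos_of_mul_pos_right h2

theorem card_inter_eq_sum (h : IsNeighborhoodDesign N q T) (U : Finset V) (v : V) :
    #(N v ∩ U) = ∑ u ∈ U, if v ∈ N u then 1 else 0 := by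
  rw [← card_filter]
  congr 1
  ext u
  simp only [mem_inter, mem_filter]
  exact ⟨fun hu => ⟨hu.2, h.symm _ _ hu.1⟩, fun hu => ⟨h.symm _ _ hu.2, hu.1⟩⟩

theorem sum_card_inter (h : IsNeighborhoodDesign N q T) (U : Finset V) :
    ∑ v, #(N v ∩ U) = q * #U := by
  simp_rw [h.card_inter_eq_sum]
  rw [sum_comm]
  simp [h.card_eq, mul_comm]

theorem sum_card_inter_sq_le (h : IsNeighborhoodDesign N q T) (U : Finset V) :
    ∑ v, #(N v ∩ U) ^ 2 ≤ q * #U + T * #U ^ 2 := by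
  have h2 : ∑ v, #(N v ∩ U) ^ 2 = ∑ u ∈ U, ∑ w ∈ U, #(N u ∩ N w) := by
    have h1 := h.card_inter_eq_sum U
    simp_rw [h1, sq, sum_mul_sum]
    rw [sum_comm]
    refine sum_congr rfl fun u _ => ?_
    rw [sum_comm]
    refine sum_congr rfl fun w _ => ?_
    rw [← filter_univ_mem (N u ∩ N w), card_filter]
    refine sum_congr rfl fun v _ => ?_
    simp only [mem_inter]
    split_ifs <;> simp_all
  rw [h2]
  calc ∑ u ∈ U, ∑ w ∈ U, #(N u ∩ N w)
      ≤ ∑ u ∈ U, ∑ w ∈ U, ((if u = w then q else 0) + T) := by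
        refine sum_le_sum fun u _ => sum_le_sum fun w _ => ?_
        split_ifs with huw
        · subst huw
          simp [h.card_eq]
        · simpa using h.card_inter_le u w huw
    _ = q * #U + T * #U ^ 2 := by
        simp only [sum_add_distrib, sum_ite_eq, sum_const, smul_eq_mul]
        rw [sum_ite_mem, inter_self, sum_const, smul_eq_mul]
        ring

/-- Chebyshev's inequality, in place of an eigenvalue bound: the mean of `#(N v ∩ U)` is `T * #U /
q`, and `D` consists of vertices with at most half of it. -/
theorem card_mul_card_le (h : IsNeighborhoodDesign N q T) (U D : Finset V)
    (hD : ∀ v ∈ D, 2 * q * #(N v ∩ U) ≤ T * #U) : #D * #U * T ^ 2 ≤ 4 * q ^ 3 := by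
  rcases Nat.eq_zero_or_pos #U with hU | hU
  · simp [hU]
  have e1 : ∑ v, (#(N v ∩ U) : ℝ) = q * #U := by exact_mod_cast h.sum_card_inter U
  have e2 : ∑ v, (#(N v ∩ U) : ℝ) ^ 2 ≤ q * #U + T * #U ^ 2 := by
    exact_mod_cast h.sum_card_inter_sq_le U
  have e3 : (Fintype.card V : ℝ) * T = q ^ 2 := by exact_mod_cast h.card_mul
  have hle : (#D : ℝ) * (T * #U / 2) ^ 2 ≤ ∑ v, ((q : ℝ) * #(N v ∩ U) - T * #U) ^ 2 := by
    calc (#D : ℝ) * (T * #U / 2) ^ 2 = ∑ v ∈ D, ((T : ℝ) * #U / 2) ^ 2 := by simp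
      _ ≤ ∑ v ∈ D, ((q : ℝ) * #(N v ∩ U) - T * #U) ^ 2 := by
          refine sum_le_sum fun v hv => ?_
          have : (2 : ℝ) * q * #(N v ∩ U) ≤ T * #U := by exact_mod_cast hD v hv
          have h0 : (0 : ℝ) ≤ q * #(N v ∩ U) := by positivity
          nlinarith
      _ ≤ _ := sum_le_sum_of_subset_of_nonneg (subset_univ _) fun _ _ _ => sq_nonneg _
  have hsum : ∑ v, ((q : ℝ) * #(N v ∩ U) - T * #U) ^ 2
      = q ^ 2 * ∑ v, (#(N v ∩ U) : ℝ) ^ 2 - 2 * q * T * #U * ∑ v, (#(N v ∩ U) : ℝ)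
        + Fintype.card V * (T * #U) ^ 2 := by
    simp_rw [sub_sq, mul_pow, sum_add_distrib, sum_sub_distrib, mul_sum]
    simp only [sum_const, card_univ, nsmul_eq_mul]
    congr 2
    exact sum_congr rfl fun v _ => by ring
  rw [hsum, e1] at hle
  have e4 : (Fintype.card V : ℝ) * (T * #U) ^ 2 = q ^ 2 * T * #U ^ 2 := by rw [← e3]; ring
  rw [e4] at hle
  have hq : (0 : ℝ) ≤ q ^ 2 := by positivity
  have h5 := mul_le_mul_of_nonneg_left e2 hq
  -- Since `n * T = q ^ 2`, the terms in `T * #U ^ 2` cancel and only `q ^ 3 * #U` is left of the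
  -- variance.
  have h6 : ((#D : ℝ) * #U * T ^ 2) * #U ≤ (4 * q ^ 3) * #U := by nlinarith
  have h7 := le_of_mul_le_mul_right h6 (by exact_mod_cast hU)
  exact_mod_cast h7

end IsNeighborhoodDesign

/-! ### Counting independent sets -/

/-- The independent `m`-subsets of `U` in the graph with neighborhoods `N`, loops ignored. -/
def independentSets {V : Type*} [DecidableEq V] (N : V → Finset V) (U : Finset V)
    (m : ℕ) : Finset (Finset V) :=
  (U.powersetCard m).filter fun S => ∀ x ∈ S, ∀ y ∈ S, x ≠ y → y ∉ N x

section independentSets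
variable {V : Type*} [DecidableEq V] {N : V → Finset V}

theorem independentSets_subset_powersetCard (U : Finset V) (m : ℕ) :
    independentSets N U m ⊆ U.powersetCard m :=
  filter_subset _ _

theorem mem_independentSets {U S : Finset V} {m : ℕ} : S ∈ independentSets N U m ↔
    (S ⊆ U ∧ #S = m) ∧ ∀ x ∈ S, ∀ y ∈ S, x ≠ y → y ∉ N x := by
  rw [independentSets, mem_filter, mem_powersetCard]

/-- Count pairs `v ∈ S`. Erasing `v` leaves an independent set that avoids `N v`, and `v` recovers
`S`. -/
theorem card_independentSets_succ (U : Finset V) (m : ℕ) :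
    (m + 1) * #(independentSets N U (m + 1)) ≤ ∑ v ∈ U, #(independentSets N (U \ N v) m) := by
  calc (m + 1) * #(independentSets N U (m + 1))
      = ∑ S ∈ independentSets N U (m + 1), ∑ v ∈ U, if v ∈ S then 1 else 0 := by
        rw [mul_comm, ← smul_eq_mul, ← sum_const]
        refine sum_congr rfl fun S hS => ?_
        obtain ⟨hS, -⟩ := mem_filter.1 hS
        obtain ⟨hSU, hSc⟩ := mem_powersetCard.1 hS
        rw [← card_filter, filter_mem_eq_inter, inter_eq_right.2 hSU, hSc]
    _ = ∑ v ∈ U, #((independentSets N U (m + 1)).filter (v ∈ ·)) := by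
        rw [sum_comm]
        simp_rw [card_filter]
    _ ≤ _ := by
        refine sum_le_sum fun v _ => ?_
        refine card_le_card_of_injOn (fun S => S.erase v) ?_ ?_
        · intro S hS
          obtain ⟨hS, hvS⟩ := mem_filter.1 hS
          obtain ⟨hS, hind⟩ := mem_filter.1 hS
          obtain ⟨hSU, hSc⟩ := mem_powersetCard.1 hS
          refine mem_filter.2 ⟨mem_powersetCard.2 ⟨?_, ?_⟩, ?_⟩
          · intro x hx
            obtain ⟨hxv, hxS⟩ := mem_erase.1 hx
            exact mem_sdiff.2 ⟨hSU hxS, hind v hvS x hxS hxv.symm⟩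
          · rw [card_erase_of_mem hvS, hSc, Nat.add_sub_cancel]
          · exact fun x hx y hy => hind x (mem_of_mem_erase hx) y (mem_of_mem_erase hy)
        · intro S hS S' hS' heq
          have h1 := (mem_filter.1 hS).2
          have h2 := (mem_filter.1 hS').2
          rw [← insert_erase h1, ← insert_erase h2]
          exact congrArg (insert v) heq

/-- The Alon–Rödl bound on the number of independent sets. -/
theorem IsNeighborhoodDesign.factorial_mul_card_independentSets_le [Fintype V] {q T : ℕ}
    (h : IsNeighborhoodDesign N q T) {L : ℝ} (hL : 1 ≤ L) (hL2 : 4 * (q : ℝ) ^ 3 ≤ L ^ 2 * T ^ 2)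
    (m s : ℕ) (U : Finset V) (hU : (#U : ℝ) * (1 - T / (2 * q)) ^ s < 1) :
    (m.factorial : ℝ) * #(independentSets N U m) ≤ 2 ^ m * Fintype.card V ^ s * L ^ m := by
  have hT : (0 : ℝ) < T := by exact_mod_cast h.pos
  have hTq : (T : ℝ) ≤ q := by exact_mod_cast h.le
  have hq : (0 : ℝ) < q := hT.trans_le hTq
  have hδ : (0 : ℝ) ≤ 1 - T / (2 * q) := by
    rw [sub_nonneg, div_le_one (by positivity)]
    linarith
  have hV : (1 : ℝ) ≤ Fintype.card V := by
    have := h.card_pos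
    exact_mod_cast this
  set n : ℝ := (Fintype.card V : ℝ)
  induction m generalizing s U with
  | zero =>
    have : #(independentSets N U 0) ≤ 1 := 
      (card_le_card (independentSets_subset_powersetCard U 0)).trans (by simp)
    have h1 : (#(independentSets N U 0) : ℝ) ≤ 1 := by exact_mod_cast this
    simpa using h1.trans (one_le_pow₀ hV)
  | succ m ih =>
    -- `D` holds the atypical choices of the next vertex. Since `#D ≤ #U`, the variance bound gives
    -- `#D ≤ L`.
    set D := U.filter fun v => 2 * q * #(N v ∩ U) ≤ T * #U with hD
    have hDL : (#D : ℝ) ≤ L := by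
      have h1 := h.card_mul_card_le U D fun v hv => (mem_filter.1 hv).2
      have h2 : (#D : ℝ) * #U * T ^ 2 ≤ 4 * q ^ 3 := by exact_mod_cast h1
      have h3 : (#D : ℝ) ≤ #U := by exact_mod_cast card_filter_le _ _
      have h4 : ((#D : ℝ) * T) ^ 2 ≤ (L * T) ^ 2 := by
        have : (#D : ℝ) * #D ≤ #D * #U := by gcongr
        nlinarith [mul_le_mul_of_nonneg_right this (sq_nonneg (T : ℝ))]
      exact le_of_mul_le_mul_right (abs_le_of_sq_le_sq' h4 (by positivity)).2 hT
    have hgood : ∀ v ∈ U \ D, (#(U \ N v) : ℝ) ≤ #U * (1 - T / (2 * q)) := by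
      intro v hv
      have hv' : (T : ℝ) * #U < 2 * q * #(N v ∩ U) := by
        have : ¬ (2 * q * #(N v ∩ U) ≤ T * #U) := fun hc =>
          (mem_sdiff.1 hv).2 (mem_filter.2 ⟨(mem_sdiff.1 hv).1, hc⟩)
        exact_mod_cast not_le.1 this
      have hc : (#(U \ N v) : ℝ) + #(N v ∩ U) = #U := by
        rw [inter_comm]
        exact_mod_cast card_sdiff_add_card_inter U (N v)
      have : (T : ℝ) / (2 * q) * #U ≤ #(N v ∩ U) := by
        rw [div_mul_eq_mul_div, div_le_iff₀ (by positivity)]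
        linarith
      linarith
    have hbad : ∀ v, (m.factorial : ℝ) * #(independentSets N (U \ N v) m)
        ≤ 2 ^ m * n ^ s * L ^ m := fun v => ih s _ <| by
      refine lt_of_le_of_lt ?_ hU
      gcongr
      exact sdiff_subset
    have hgood' : ∑ v ∈ U \ D, (m.factorial : ℝ) * #(independentSets N (U \ N v) m)
        ≤ 2 ^ m * n ^ s * L ^ m := by
      -- `s` is a budget of typical choices: each one spends a unit, and a zero budget forces `U` to
      -- be empty.
      rcases s with _ | s
      · have : U = ∅ := by
          rw [pow_zero, mul_one] at hU
          have : #U < 1 := by exact_mod_cast hU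
          exact card_eq_zero.1 (by omega)
        rw [this, empty_sdiff, sum_empty]
        positivity
      · calc ∑ v ∈ U \ D, (m.factorial : ℝ) * #(independentSets N (U \ N v) m)
            ≤ ∑ v ∈ U \ D, 2 ^ m * n ^ s * L ^ m := by
              refine sum_le_sum fun v hv => ih s _ ?_
              refine lt_of_le_of_lt ?_ hU
              rw [pow_succ', ← mul_assoc]
              gcongr
              exact hgood v hv
          _ = #(U \ D) * (2 ^ m * n ^ s * L ^ m) := by simp
          _ ≤ n * (2 ^ m * n ^ s * L ^ m) := by
              gcongr
              exact Nat.cast_le.2 (card_le_univ _)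
          _ = _ := by ring
    have hsucc : ((m : ℝ) + 1) * #(independentSets N U (m + 1))
        ≤ ∑ v ∈ U, (#(independentSets N (U \ N v) m) : ℝ) := by
      exact_mod_cast card_independentSets_succ U m
    calc ((m + 1).factorial : ℝ) * #(independentSets N U (m + 1))
        = m.factorial * (((m : ℝ) + 1) * #(independentSets N U (m + 1))) := by
          rw [Nat.factorial_succ]
          push_cast
          ring
      _ ≤ m.factorial * ∑ v ∈ U, (#(independentSets N (U \ N v) m) : ℝ) := by gcongr
      _ = ∑ v ∈ U \ D, (m.factorial : ℝ) * #(independentSets N (U \ N v) m)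
          + ∑ v ∈ D, (m.factorial : ℝ) * #(independentSets N (U \ N v) m) := by
          rw [mul_sum, sum_sdiff (filter_subset _ _)]
      _ ≤ 2 ^ m * n ^ s * L ^ m + #D * (2 ^ m * n ^ s * L ^ m) := by
          gcongr
          refine (sum_le_sum fun v _ => hbad v).trans ?_
          simp
      -- Typical and atypical choices each cost at most `L` here, as `1 ≤ L`; the two cases give the
      -- factor 2 per vertex.
      _ ≤ L * (2 ^ m * n ^ s * L ^ m) + L * (2 ^ m * n ^ s * L ^ m) := by
          have : 0 ≤ 2 ^ m * n ^ s * L ^ m := by positivity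
          exact add_le_add (le_mul_of_one_le_left this hL) (mul_le_mul_of_nonneg_right hDL this)
      _ = 2 ^ (m + 1) * n ^ s * L ^ (m + 1) := by ring

end independentSets

/-! ### Random copies -/

theorem exists_perm_map_eq {V : Type*} [Fintype V] [DecidableEq V] {S S' : Finset V}
    (h : #S = #S') : ∃ τ : Equiv.Perm V, S.map τ.toEmbedding = S' := by
  let e : S ≃ S' := S.equivOfCardEq h
  refine ⟨e.extendSubtype, eq_of_subset_of_card_le ?_ (by simp [h])⟩
  intro x hx
  obtain ⟨y, hy, rfl⟩ := mem_map.1 hx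
  change e.extendSubtype y ∈ S'
  rw [Equiv.extendSubtype_apply_of_mem e y hy]
  exact (e ⟨y, hy⟩).2

section perms
variable {V : Type*} [Fintype V] [DecidableEq V] {m : ℕ}

/-- A uniform permutation sends `S` to a uniform `m`-set: precomposing with a permutation shows that
the count is the same for all `m`-sets, and it is then summed over them. -/
theorem card_perm_map_mem_mul_choose {I : Finset (Finset V)} (hI : I ⊆ univ.powersetCard m)
    {S : Finset V} (hS : #S = m) :
    #{σ : Equiv.Perm V | S.map σ.toEmbedding ∈ I} * (Fintype.card V).choose m
      = Fintype.card (Equiv.Perm V) * #I := by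
  have hconst : ∀ S' ∈ (univ : Finset V).powersetCard m,
      #{σ : Equiv.Perm V | S'.map σ.toEmbedding ∈ I}
        = #{σ : Equiv.Perm V | S.map σ.toEmbedding ∈ I} := by
    intro S' hS'
    obtain ⟨τ, rfl⟩ := exists_perm_map_eq (hS.trans (mem_powersetCard.1 hS').2.symm)
    refine card_bij (fun σ _ => τ.trans σ) ?_ ?_ ?_
    · intro σ hσ
      simpa [map_map] using hσ
    · intro σ _ σ' _ h
      ext x
      simpa using Equiv.congr_fun h (τ.symm x)
    · intro σ hσ
      refine ⟨τ.symm.trans σ, ?_, by ext; simp⟩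
      have : τ.toEmbedding.trans (τ.symm.trans σ).toEmbedding = σ.toEmbedding := by
        ext; simp
      simp only [mem_filter, mem_univ, true_and] at hσ ⊢
      rwa [map_map, this]
  have hinj : ∀ σ : Equiv.Perm V,
      #{S' ∈ (univ : Finset V).powersetCard m | S'.map σ.toEmbedding ∈ I} = #I := by
    intro σ
    refine card_bij (fun S' _ => S'.map σ.toEmbedding) (fun S' hS' => (mem_filter.1 hS').2)
      (fun _ _ _ _ h => map_injective _ h) fun S' hS' => ?_
    have : (S'.map σ.symm.toEmbedding).map σ.toEmbedding = S' := by
      rw [map_map]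
      ext x
      simp
    refine ⟨S'.map σ.symm.toEmbedding, mem_filter.2 ⟨mem_powersetCard.2 ⟨subset_univ _, ?_⟩, ?_⟩, this⟩
    · rw [card_map]
      exact (mem_powersetCard.1 (hI hS')).2
    · rwa [this]
  calc _ = ∑ S' ∈ (univ : Finset V).powersetCard m,
        #{σ : Equiv.Perm V | S'.map σ.toEmbedding ∈ I} := by
        rw [sum_congr rfl hconst, sum_const, card_powersetCard, card_univ, smul_eq_mul, mul_comm]
    _ = ∑ σ : Equiv.Perm V,
        #{S' ∈ (univ : Finset V).powersetCard m | S'.map σ.toEmbedding ∈ I} := by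
        simp_rw [card_filter]
        exact sum_comm
    _ = _ := by simp [hinj]

theorem exists_perm_card_filter_map_mem {B I : Finset (Finset V)}
    (hB : B ⊆ univ.powersetCard m) (hI : I ⊆ univ.powersetCard m) :
    ∃ σ : Equiv.Perm V,
      #{S ∈ B | S.map σ.toEmbedding ∈ I} * (Fintype.card V).choose m ≤ #B * #I := by
  have hsum : ∑ σ : Equiv.Perm V, #{S ∈ B | S.map σ.toEmbedding ∈ I} * (Fintype.card V).choose m
      ≤ ∑ _σ : Equiv.Perm V, #B * #I := by
    apply le_of_eq
    calc _ = ∑ S ∈ B, #{σ : Equiv.Perm V | S.map σ.toEmbedding ∈ I} *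
          (Fintype.card V).choose m := by
          rw [← sum_mul, ← sum_mul]
          simp_rw [card_filter]
          rw [sum_comm]
      _ = ∑ S ∈ B, Fintype.card (Equiv.Perm V) * #I := sum_congr rfl fun S hS =>
          card_perm_map_mem_mul_choose hI (mem_powersetCard.1 (hB hS)).2
      _ = _ := by
          rw [sum_const, sum_const, card_univ, smul_eq_mul, smul_eq_mul]
          ring
  obtain ⟨σ, -, hσ⟩ := exists_le_of_sum_le univ_nonempty hsum
  exact ⟨σ, hσ⟩

/-- Copies are chosen one at a time; by averaging, some choice cuts the family of surviving sets by
the factor `#I / C(n,m)`. -/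
theorem exists_perms_card_filter_map_mem {I : Finset (Finset V)}
    (hI : I ⊆ univ.powersetCard m) (k : ℕ) :
    ∃ σ : Fin k → Equiv.Perm V,
      #{S ∈ (univ : Finset V).powersetCard m | ∀ i, S.map (σ i).toEmbedding ∈ I} *
        (Fintype.card V).choose m ^ k ≤ #I ^ k * (Fintype.card V).choose m := by
  induction k with
  | zero => exact ⟨Fin.elim0, by simp⟩
  | succ k ih =>
    obtain ⟨σ, hσ⟩ := ih
    set B := {S ∈ (univ : Finset V).powersetCard m | ∀ i, S.map (σ i).toEmbedding ∈ I}
    obtain ⟨τ, hτ⟩ := exists_perm_card_filter_map_mem (filter_subset _ _ : B ⊆ _) hI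
    refine ⟨Fin.cons τ σ, ?_⟩
    have : {S ∈ (univ : Finset V).powersetCard m |
        ∀ i, S.map ((Fin.cons τ σ : Fin (k + 1) → Equiv.Perm V) i).toEmbedding ∈ I}
        = {S ∈ B | S.map τ.toEmbedding ∈ I} := by
      ext S
      simp only [B, mem_filter, Fin.forall_fin_succ, Fin.cons_zero, Fin.cons_succ]
      tauto
    rw [this]
    calc #{S ∈ B | S.map τ.toEmbedding ∈ I} * (Fintype.card V).choose m ^ (k + 1)
        = #{S ∈ B | S.map τ.toEmbedding ∈ I} * (Fintype.card V).choose m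
          * (Fintype.card V).choose m ^ k := by ring
      _ ≤ #B * #I * (Fintype.card V).choose m ^ k := Nat.mul_le_mul_right _ hτ
      _ = #B * (Fintype.card V).choose m ^ k * #I := by ring
      _ ≤ #I ^ k * (Fintype.card V).choose m * #I := Nat.mul_le_mul_right _ hσ
      _ = _ := by ring

theorem exists_perms_forall_exists_map_notMem {I : Finset (Finset V)}
    (hI : I ⊆ univ.powersetCard m) {k : ℕ}
    (hcard : #I ^ k * (Fintype.card V).choose m < (Fintype.card V).choose m ^ k) :
    ∃ σ : Fin k → Equiv.Perm V, ∀ S : Finset V, #S = m → ∃ i, S.map (σ i).toEmbedding ∉ I := by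
  obtain ⟨σ, hσ⟩ := exists_perms_card_filter_map_mem hI k
  refine ⟨σ, fun S hS => ?_⟩
  by_contra! hSI
  have hpos : 1 ≤ #{S ∈ (univ : Finset V).powersetCard m | ∀ i, S.map (σ i).toEmbedding ∈ I} :=
    card_pos.2 ⟨S, mem_filter.2 ⟨mem_powersetCard.2 ⟨subset_univ _, hS⟩, hSI⟩⟩
  have := Nat.mul_le_mul_right ((Fintype.card V).choose m ^ k) hpos
  omega

end perms

/-- The simple graph with neighborhoods `N`, loops removed. -/
def graphOfNeighborhoods {V : Type*} (N : V → Finset V) : SimpleGraph V :=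
  SimpleGraph.fromRel fun x y => y ∈ N x

theorem IsNeighborhoodDesign.free {V : Type*} [Fintype V] [DecidableEq V] {N : V → Finset V}
    {q T t : ℕ} (h : IsNeighborhoodDesign N q T) (hTt : T < t) :
    (bipartiteK 2 t).Free (graphOfNeighborhoods N) := by
  have hadj : ∀ x y, (graphOfNeighborhoods N).Adj x y → y ∈ N x := fun x y hxy => by
    obtain ⟨-, h1 | h1⟩ := (SimpleGraph.fromRel_adj _ _ _).1 hxy
    · exact h1
    · exact h.symm _ _ h1
  rintro ⟨g⟩
  have hne : g (Sum.inl 0) ≠ g (Sum.inl 1) := fun he => by simpa using g.injective he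
  have hsub : univ.image (fun j : Fin t => g (Sum.inr j))
      ⊆ N (g (Sum.inl 0)) ∩ N (g (Sum.inl 1)) := by
    intro x hx
    obtain ⟨j, -, rfl⟩ := mem_image.1 hx
    exact mem_inter.2 ⟨hadj _ _ (g.toHom.map_adj (by simp)), hadj _ _ (g.toHom.map_adj (by simp))⟩
  have hinj : Function.Injective fun j : Fin t => g (Sum.inr j) :=
    fun a b hab => Sum.inr_injective (g.injective hab)
  have h1 := card_le_card hsub
  rw [card_image_of_injective _ hinj, card_univ, Fintype.card_fin] at h1
  have := h.card_inter_le _ _ hne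
  omega

theorem IsNeighborhoodDesign.card_lt_ramseyRep {V : Type} [Fintype V] [DecidableEq V]
    {N : V → Finset V} {q T t m k l : ℕ} (h : IsNeighborhoodDesign N q T) (hTt : T < t)
    (hl : 0 < l) (hlk : l ≤ k)
    (hcard : #(independentSets N univ m) ^ l * (Fintype.card V).choose m
      < (Fintype.card V).choose m ^ l) :
    Fintype.card V < ramseyRep k (bipartiteK 2 t) (completeK m) := by
  obtain ⟨σ, hσ⟩ := exists_perms_forall_exists_map_notMem
    (independentSets_subset_powersetCard (N := N) univ m) hcard
  refine _root_.card_lt_ramseyRep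
    -- Only `l` copies are needed; any further colours repeat the last one.
    (fun i => (graphOfNeighborhoods N).comap (σ ⟨min i (l - 1), by omega⟩))
    (fun i hc => h.free hTt (hc.trans ⟨SimpleGraph.Embedding.toCopy
      (SimpleGraph.Embedding.comap (σ ⟨min i (l - 1), by omega⟩).toEmbedding _)⟩)) ?_
  intro S hS
  obtain ⟨i, hi⟩ := hσ S hS
  have hil : (⟨min i (l - 1), by omega⟩ : Fin l) = i := by
    ext
    have := i.2
    simp only
    omega
  refine ⟨⟨i, by omega⟩, ?_⟩
  simp only [hil]
  by_contra! hind
  refine hi (mem_independentSets.2 ⟨⟨subset_univ _, by simp [hS]⟩, ?_⟩)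
  intro x' hx' y' hy' hxy hyx
  obtain ⟨x, hx, rfl⟩ := mem_map.1 hx'
  obtain ⟨y, hy, rfl⟩ := mem_map.1 hy'
  exact hind x hx y hy
    ((SimpleGraph.fromRel_adj (fun a b => b ∈ N a) (σ i x) (σ i y)).2 ⟨hxy, Or.inl hyx⟩)

/-! ### The algebraic construction -/

theorem card_ker_mul_card {F W : Type*} [AddCommGroup F] [AddCommGroup W] [Fintype F] [Fintype W]
    [DecidableEq W] (φ : F →+ W) (hφ : Function.Surjective φ) (w : W) :
    #{x | φ x = w} * Fintype.card W = Fintype.card F := by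
  have hfib : ∀ w' ∈ (univ : Finset W), #{x | φ x = w'} = #{x | φ x = w} := fun w' _ => by
    obtain ⟨a, ha⟩ := hφ (w' - w)
    refine card_bij (fun x _ => x - a) (fun x hx => ?_) (fun x _ y _ h => sub_left_injective h)
      fun y hy => ⟨y + a, ?_, by simp⟩
    · simp only [mem_filter, mem_univ, true_and] at hx ⊢
      rw [map_sub, hx, ha, sub_sub_cancel]
    · simp only [mem_filter, mem_univ, true_and] at hy ⊢
      rw [map_add, hy, ha, add_sub_cancel]
  rw [← card_univ (α := F),
    card_eq_sum_card_fiberwise (s := (univ : Finset F)) (f := φ) (t := univ) (by simp), sum_congr rfl hfib, sum_const, smul_eq_mul, card_univ, mul_comm]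

/-- A common neighbour `x` of `u` and `v` satisfies `φ((u₁ - v₁)x₁) = u₂ - v₂`. If `u₁ ≠ v₁`, this
leaves `T` values of `x₁`, each of which determines `x`; if `u₁ = v₁`, it forces `u = v`. -/
theorem isNeighborhoodDesign_of_surjective {F W : Type*} [Field F] [AddCommGroup W]
    [Fintype F] [Fintype W] [DecidableEq F] [DecidableEq W] (φ : F →+ W)
    (hφ : Function.Surjective φ) {T : ℕ} (hT : T * Fintype.card W = Fintype.card F) :
    IsNeighborhoodDesign (fun v : F × W => univ.filter fun u : F × W => v.2 + u.2 = φ (v.1 * u.1))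
      (Fintype.card F) T where
  symm u v h := by
    simp only [mem_filter, mem_univ, true_and] at h ⊢
    rw [add_comm, h, mul_comm]
  card_eq v := by
    rw [← card_univ (α := F)]
    refine card_bij (fun u _ => u.1) (fun _ _ => mem_univ _) ?_
      fun x _ => ⟨(x, φ (v.1 * x) - v.2), by simp, rfl⟩
    intro u hu u' hu' h
    simp only [mem_filter, mem_univ, true_and] at hu hu' h
    refine Prod.ext h (add_left_cancel (a := v.2) ?_)
    rw [hu, hu', h]
  card_inter_le := by
    have hker (w : W) : #{x | φ x = w} = T :=
      Nat.eq_of_mul_eq_mul_right (Fintype.card_pos (α := W)) ((card_ker_mul_card φ hφ w).trans hT.symm)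
    intro u v huv
    rw [← hker (u.2 - v.2)]
    by_cases h1 : u.1 = v.1
    · refine (Nat.le_zero.2 (card_eq_zero.2 (eq_empty_of_forall_notMem fun x hx => huv ?_))).trans
        (Nat.zero_le _)
      simp only [mem_inter, mem_filter, mem_univ, true_and] at hx
      refine Prod.ext h1 (add_right_cancel (b := x.2) ?_)
      rw [hx.1, hx.2, h1]
    · refine card_le_card_of_injOn (fun x => (u.1 - v.1) * x.1) ?_ ?_
      · intro x hx
        simp only [mem_coe, mem_inter, mem_filter, mem_univ, true_and] at hx ⊢
        rw [sub_mul, map_sub, ← hx.1, ← hx.2]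
        abel
      · intro x hx y hy hxy
        simp only [mem_coe, mem_inter, mem_filter, mem_univ, true_and] at hx hy
        have h2 : x.1 = y.1 := mul_left_cancel₀ (sub_ne_zero.2 h1) hxy
        refine Prod.ext h2 (add_left_cancel (a := u.2) ?_)
        rw [hx.1, hy.1, h2]
  card_mul := by
    rw [Fintype.card_prod, mul_assoc, mul_comm _ T, hT, sq]
  pos := Nat.pos_of_ne_zero fun h => by
    rw [h, zero_mul] at hT
    exact Fintype.card_ne_zero hT.symm
  le := hT ▸ Nat.le_mul_of_pos_right _ Fintype.card_pos

theorem exists_isNeighborhoodDesign {i j : ℕ} (hij : i ≤ j) :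
    ∃ (V : Type) (_ : Fintype V) (_ : DecidableEq V) (N : V → Finset V),
      IsNeighborhoodDesign N (2 ^ j) (2 ^ i) := by
  classical
  -- No field has `2 ^ 0` elements; a single vertex with a loop serves instead.
  rcases Nat.eq_zero_or_pos j with rfl | hj
  · obtain rfl : i = 0 := by omega
    refine ⟨Unit, inferInstance, inferInstance, fun _ => univ, ?_⟩
    constructor <;> simp
  let F := GaloisField 2 j
  have : Fintype F := Fintype.ofFinite F
  have hF : Fintype.card F = 2 ^ j := by
    rw [← Nat.card_eq_fintype_card, GaloisField.card 2 j hj.ne']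
  have hfin : Module.finrank (ZMod 2) F = j := GaloisField.finrank 2 hj.ne'
  let b := Module.finBasisOfFinrankEq (ZMod 2) F hfin
  let φ : F →ₗ[ZMod 2] (Fin (j - i) → ZMod 2) :=
    (LinearMap.funLeft (ZMod 2) (ZMod 2) (Fin.castLE (by omega : j - i ≤ j))).comp
      b.equivFun.toLinearMap
  have hφ : Function.Surjective φ := by
    rw [LinearMap.coe_comp]
    exact (LinearMap.funLeft_surjective_of_injective _ _ _ (Fin.castLE_injective _)).comp
      b.equivFun.surjective
  refine ⟨_, inferInstance, inferInstance, _, hF ▸ isNeighborhoodDesign_of_surjective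
    φ.toAddMonoidHom hφ (T := 2 ^ i) ?_⟩
  rw [hF]
  simp [← pow_add, hij]

/-! ### Numerical estimates for two and three copies -/

theorem div_exp_one_pow_le_factorial (m : ℕ) : ((m : ℝ) / Real.exp 1) ^ m ≤ m.factorial := by
  have h := Real.pow_div_factorial_le_exp (m : ℝ) (Nat.cast_nonneg m) m
  rw [div_le_iff₀ (by positivity)] at h
  rw [div_pow, div_le_iff₀ (by positivity), ← Real.exp_nat_mul, mul_one, mul_comm]
  exact h

theorem half_pow_le_choose_mul_factorial {n m : ℕ} (h : 2 * m ≤ n) :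
    ((n : ℝ) / 2) ^ m ≤ n.choose m * m.factorial := by
  have h1 := Nat.pow_sub_le_descFactorial n m
  rw [Nat.descFactorial_eq_factorial_mul_choose, mul_comm] at h1
  refine le_trans ?_ (by exact_mod_cast h1 : ((n + 1 - m : ℕ) : ℝ) ^ m ≤ n.choose m * m.factorial)
  refine pow_le_pow_left₀ (by positivity) ?_ m
  rw [div_le_iff₀ two_pos]
  exact_mod_cast (by omega : n ≤ (n + 1 - m) * 2)

namespace IsNeighborhoodDesign
variable {V : Type} [Fintype V] [DecidableEq V] {N : V → Finset V} {q T : ℕ}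

theorem exists_mul_pow_lt_one (h : IsNeighborhoodDesign N q T) :
    ∃ s : ℕ, (Fintype.card V : ℝ) * (1 - T / (2 * q)) ^ s < 1 ∧
      (s : ℝ) ≤ 2 * (q / T) * Real.log (Fintype.card V) + 1 := by
  have hT : (0 : ℝ) < T := by exact_mod_cast h.pos
  have hTq : (T : ℝ) ≤ q := by exact_mod_cast h.le
  have hq : (0 : ℝ) < q := hT.trans_le hTq
  have hV : (1 : ℝ) ≤ Fintype.card V := by exact_mod_cast h.card_pos
  set n : ℝ := (Fintype.card V : ℝ)
  have hlog : 0 ≤ Real.log n := Real.log_nonneg hV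
  have h0 : 0 ≤ 2 * ((q : ℝ) / T) * Real.log n := by positivity
  refine ⟨⌊2 * ((q : ℝ) / T) * Real.log n⌋₊ + 1, ?_, ?_⟩
  · have hs := Nat.lt_floor_add_one (2 * ((q : ℝ) / T) * Real.log n)
    set s := ⌊2 * ((q : ℝ) / T) * Real.log n⌋₊ + 1 with hs_def
    have hs' : 2 * ((q : ℝ) / T) * Real.log n < s := by rw [hs_def]; exact_mod_cast hs
    have hδ : (0 : ℝ) ≤ 1 - T / (2 * q) := by
      rw [sub_nonneg, div_le_one (by positivity)]
      linarith
    have h1 : (1 - (T : ℝ) / (2 * q)) ^ s ≤ Real.exp (-(s * (T / (2 * q)))) := by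
      have := pow_le_pow_left₀ hδ (Real.one_sub_le_exp_neg ((T : ℝ) / (2 * q))) s
      rwa [← Real.exp_nat_mul, mul_neg] at this
    have h2 : Real.log n < s * (T / (2 * q)) := by
      have := mul_lt_mul_of_pos_right hs' (by positivity : 0 < (T : ℝ) / (2 * q))
      have e : 2 * ((q : ℝ) / T) * Real.log n * (T / (2 * q)) = Real.log n := by field_simp
      linarith
    calc n * (1 - (T : ℝ) / (2 * q)) ^ s ≤ n * Real.exp (-(s * (T / (2 * q)))) := by gcongr
      _ < n * Real.exp (-Real.log n) := by gcongr
      _ = 1 := by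
        rw [Real.exp_neg, Real.exp_log (by positivity)]
        field_simp
  · push_cast
    have := Nat.floor_le h0
    linarith

theorem log_card_le (h : IsNeighborhoodDesign N q T) :
    Real.log (Fintype.card V) ≤ 2 * Real.log q := by
  have h1 : Fintype.card V ≤ q ^ 2 := h.card_mul ▸ Nat.le_mul_of_pos_right _ h.pos
  have h2 : (Fintype.card V : ℝ) ≤ (q : ℝ) ^ 2 := by exact_mod_cast h1
  have h3 := Real.log_le_log (by exact_mod_cast h.card_pos) h2
  rwa [Real.log_pow, Nat.cast_ofNat] at h3

/-- Squaring removes the root from `L = √(4q³/T²)`. The constant is `5 = 4 + 1`, from `log n ≤ 2l`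
and `1 ≤ (q/T) l`. -/
theorem exists_sq_factorial_mul_card_le (h : IsNeighborhoodDesign N q T) {l : ℝ} (hl : 1 ≤ l)
    (hql : Real.log q ≤ l) (m : ℕ) :
    ∃ s : ℕ, (s : ℝ) ≤ 5 * (q / T) * l ∧
      ((m.factorial : ℝ) * #(independentSets N univ m)) ^ 2
        ≤ (Fintype.card V : ℝ) ^ (2 * s) * (16 * q ^ 3 / T ^ 2) ^ m := by
  obtain ⟨s, hs, hs'⟩ := h.exists_mul_pow_lt_one
  have hT : (1 : ℝ) ≤ T := by exact_mod_cast h.pos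
  have hTq : (T : ℝ) ≤ q := by exact_mod_cast h.le
  have hq : (1 : ℝ) ≤ q := hT.trans hTq
  have hqT : 1 ≤ (q : ℝ) / T := by rwa [one_le_div (by positivity)]
  refine ⟨s, hs'.trans ?_, ?_⟩
  · have := h.log_card_le
    have h1 : 2 * ((q : ℝ) / T) * Real.log (Fintype.card V) ≤ 2 * (q / T) * (2 * l) := by
      gcongr
      linarith
    have h2 : 1 ≤ (q : ℝ) / T * l := one_le_mul_of_one_le_of_one_le hqT hl
    linarith
  · have hLsq : Real.sqrt (4 * q ^ 3 / T ^ 2) ^ 2 = 4 * (q : ℝ) ^ 3 / T ^ 2 :=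
      Real.sq_sqrt (by positivity)
    have hb := h.factorial_mul_card_independentSets_le (L := Real.sqrt (4 * q ^ 3 / T ^ 2)) ?_ ?_
      m s univ (by simpa using hs)
    · refine (pow_le_pow_left₀ (by positivity) hb 2).trans_eq ?_
      rw [mul_pow, mul_pow, ← pow_mul, ← pow_mul, ← pow_mul, mul_comm m 2, pow_mul, pow_mul _ 2 m,
        hLsq, mul_comm s 2, mul_right_comm, ← mul_pow, mul_comm]
      congr 2
      ring
    · rw [Real.one_le_sqrt, one_le_div (by positivity)]
      have : (T : ℝ) ^ 2 ≤ q ^ 2 := by gcongr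
      nlinarith [mul_le_mul_of_nonneg_left hq (sq_nonneg (q : ℝ))]
    · rw [hLsq, div_mul_cancel₀]
      positivity

/-- Two copies need `I ^ 2 < C`. There is no spare power of `q`, so `n ^ (2s)` has to be at most `e
^ m`; as `s` already carries a logarithm, this costs a second one. -/
theorem card_lt_ramseyRep_two (h : IsNeighborhoodDesign N q T) {t m : ℕ} (hTt : T < t)
    (hm : 2 * m ≤ Fintype.card V) (hm0 : 0 < m) {l : ℝ} (hl : 1 ≤ l) (hql : Real.log q ≤ l)
    (hmT : 700 * q * l ^ 2 ≤ m * T) :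
    Fintype.card V < ramseyRep 2 (bipartiteK 2 t) (completeK m) := by
  refine h.card_lt_ramseyRep hTt (l := 2) two_pos le_rfl ?_
  obtain ⟨s, hs, hI⟩ := h.exists_sq_factorial_mul_card_le hl hql m
  have hT : (1 : ℝ) ≤ T := by exact_mod_cast h.pos
  have hq : (1 : ℝ) ≤ q := hT.trans (by exact_mod_cast h.le)
  have hV : (1 : ℝ) ≤ Fintype.card V := by exact_mod_cast h.card_pos
  have hC := half_pow_le_choose_mul_factorial hm
  have hmf := div_exp_one_pow_le_factorial m
  have hn : (Fintype.card V : ℝ) = q ^ 2 / T := by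
    rw [eq_div_iff (by positivity)]
    exact_mod_cast h.card_mul
  set I := #(independentSets N univ m)
  set C := (Fintype.card V).choose m
  have hlog := h.log_card_le
  have hpow : (Fintype.card V : ℝ) ^ (2 * s) ≤ Real.exp 1 ^ m := by
    rw [← Real.exp_log (by positivity : (0 : ℝ) < Fintype.card V), ← Real.exp_nat_mul,
      ← Real.exp_nat_mul, mul_one, Real.exp_le_exp]
    have h1 : ((2 * s : ℕ) : ℝ) * Real.log (Fintype.card V) ≤ 2 * (5 * (q / T) * l) * (2 * l) := by
      push_cast
      gcongr
      linarith
    refine h1.trans ?_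
    have h2 : 2 * (5 * ((q : ℝ) / T) * l) * (2 * l) = 20 * q * l ^ 2 / T := by ring
    rw [h2, div_le_iff₀ (by positivity)]
    have : 0 ≤ q * l ^ 2 := by positivity
    nlinarith
  have hbase : Real.exp 1 * (16 * (q : ℝ) ^ 3 / T ^ 2) < m / Real.exp 1 * (q ^ 2 / T / 2) := by
    have he := Real.exp_one_lt_d9
    have he2 : Real.exp 1 * Real.exp 1 < 9 := by nlinarith [Real.exp_pos 1]
    have h1 : 288 * (q : ℝ) < m * T := by nlinarith [one_le_pow₀ hl (n := 2)]
    have e1 : Real.exp 1 * (16 * (q : ℝ) ^ 3 / T ^ 2)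
        = (32 * (Real.exp 1 * Real.exp 1) * q) * (q ^ 2 / (2 * T ^ 2 * Real.exp 1)) := by
      field_simp; ring
    have e2 : (m : ℝ) / Real.exp 1 * (q ^ 2 / T / 2)
        = (m * T) * (q ^ 2 / (2 * T ^ 2 * Real.exp 1)) := by field_simp
    rw [e1, e2]
    refine mul_lt_mul_of_pos_right ?_ (by positivity)
    nlinarith
  have key : ((m.factorial : ℝ) * I) ^ 2 < m.factorial * (C * m.factorial) := by
    calc ((m.factorial : ℝ) * I) ^ 2 ≤ Real.exp 1 ^ m * (16 * q ^ 3 / T ^ 2) ^ m :=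
          hI.trans (by gcongr)
      _ = (Real.exp 1 * (16 * q ^ 3 / T ^ 2)) ^ m := (mul_pow _ _ _).symm
      _ < (m / Real.exp 1 * (q ^ 2 / T / 2)) ^ m :=
          pow_lt_pow_left₀ hbase (by positivity) hm0.ne'
      _ = (m / Real.exp 1) ^ m * (q ^ 2 / T / 2) ^ m := mul_pow _ _ _
      _ ≤ m.factorial * (C * m.factorial) := by
          rw [hn] at hC
          gcongr
  have hmpos : (0 : ℝ) < (m.factorial : ℝ) ^ 2 := by positivity
  have hIC : (I : ℝ) ^ 2 < C := by
    refine lt_of_mul_lt_mul_left (a := (m.factorial : ℝ) ^ 2) ?_ hmpos.le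
    calc _ = ((m.factorial : ℝ) * I) ^ 2 := by ring
      _ < _ := key
      _ = _ := by ring
  have hIC' : I ^ 2 < C := by exact_mod_cast hIC
  rw [sq C]
  exact Nat.mul_lt_mul_of_pos_right hIC' (by omega)

/-- Three copies need `I ^ 3 < C ^ 2`. Squared, this has a spare factor `q ^ m`, which absorbs `n ^
(6s) ≤ q ^ (12s)` once `12s ≤ m`, so one logarithm suffices. -/
theorem card_lt_ramseyRep_of_three_le (h : IsNeighborhoodDesign N q T) {t m k : ℕ} (hk : 3 ≤ k)
    (hTt : T < t) (hm : 2 * m ≤ Fintype.card V) (hm0 : 0 < m) {l : ℝ} (hl : 1 ≤ l)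
    (hql : Real.log q ≤ l) (hmT : 700 * q * l ≤ m * T) :
    Fintype.card V < ramseyRep k (bipartiteK 2 t) (completeK m) := by
  refine h.card_lt_ramseyRep hTt (l := 3) three_pos hk ?_
  obtain ⟨s, hs, hI⟩ := h.exists_sq_factorial_mul_card_le hl hql m
  have hT : (1 : ℝ) ≤ T := by exact_mod_cast h.pos
  have hq : (1 : ℝ) ≤ q := hT.trans (by exact_mod_cast h.le)
  have hV : (1 : ℝ) ≤ Fintype.card V := by exact_mod_cast h.card_pos
  have hC := half_pow_le_choose_mul_factorial hm
  have hmf := div_exp_one_pow_le_factorial m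
  have hn : (Fintype.card V : ℝ) = q ^ 2 / T := by
    rw [eq_div_iff (by positivity)]
    exact_mod_cast h.card_mul
  set I := #(independentSets N univ m)
  set C := (Fintype.card V).choose m
  have hsm : 12 * s ≤ m := by
    have : (12 : ℝ) * s ≤ m := by
      have h1 : 12 * (5 * ((q : ℝ) / T) * l) = 60 * q * l / T := by ring
      have h2 : 60 * (q : ℝ) * l / T ≤ m := by
        rw [div_le_iff₀ (by positivity)]
        have : 0 ≤ q * l := by positivity
        nlinarith
      linarith
    exact_mod_cast this
  have hpow : ((Fintype.card V : ℝ) ^ (2 * s)) ^ 3 ≤ (q : ℝ) ^ m := by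
    have h1 : (Fintype.card V : ℝ) ≤ q ^ 2 := hn ▸ div_le_self (by positivity) hT
    calc ((Fintype.card V : ℝ) ^ (2 * s)) ^ 3 ≤ (((q : ℝ) ^ 2) ^ (2 * s)) ^ 3 := by gcongr
      _ = (q : ℝ) ^ (12 * s) := by
          rw [← pow_mul, ← pow_mul]
          congr 1
          ring
      _ ≤ (q : ℝ) ^ m := pow_le_pow_right₀ hq hsm
  have hbase : (q : ℝ) * (16 * q ^ 3 / T ^ 2) ^ 3 < (m / Real.exp 1) ^ 2 * (q ^ 2 / T / 2) ^ 4 := by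
    have he := Real.exp_one_lt_d9
    -- The tightest use of the constant 700: `256e` is about 696.
    have h1 : 256 * Real.exp 1 * (q : ℝ) < m * T := by nlinarith
    have h2 := pow_lt_pow_left₀ h1 (by positivity) two_ne_zero
    have e1 : (q : ℝ) * (16 * q ^ 3 / T ^ 2) ^ 3
        = (256 * Real.exp 1 * q) ^ 2 * (q ^ 8 / (16 * T ^ 6 * Real.exp 1 ^ 2)) := by
      field_simp; ring
    have e2 : ((m : ℝ) / Real.exp 1) ^ 2 * (q ^ 2 / T / 2) ^ 4
        = (m * T) ^ 2 * (q ^ 8 / (16 * T ^ 6 * Real.exp 1 ^ 2)) := by field_simp; ring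
    rw [e1, e2]
    gcongr
  have key : (((m.factorial : ℝ) * I) ^ 2) ^ 3
      < (m.factorial : ℝ) ^ 2 * (C * m.factorial) ^ 4 := by
    calc (((m.factorial : ℝ) * I) ^ 2) ^ 3
        ≤ ((Fintype.card V : ℝ) ^ (2 * s) * (16 * q ^ 3 / T ^ 2) ^ m) ^ 3 := by gcongr
      _ = ((Fintype.card V : ℝ) ^ (2 * s)) ^ 3 * ((16 * q ^ 3 / T ^ 2) ^ 3) ^ m := by
          rw [mul_pow, ← pow_mul _ m, ← pow_mul _ 3, mul_comm m 3]
      _ ≤ (q : ℝ) ^ m * ((16 * q ^ 3 / T ^ 2) ^ 3) ^ m := by gcongr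
      _ = ((q : ℝ) * (16 * q ^ 3 / T ^ 2) ^ 3) ^ m := (mul_pow _ _ _).symm
      _ < ((m / Real.exp 1) ^ 2 * (q ^ 2 / T / 2) ^ 4) ^ m :=
          pow_lt_pow_left₀ hbase (by positivity) hm0.ne'
      _ = ((m / Real.exp 1) ^ m) ^ 2 * ((q ^ 2 / T / 2) ^ m) ^ 4 := by
          rw [mul_pow, ← pow_mul, ← pow_mul, ← pow_mul, ← pow_mul, mul_comm m 2, mul_comm m 4]
      _ ≤ (m.factorial : ℝ) ^ 2 * (C * m.factorial) ^ 4 := by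
          rw [hn] at hC
          gcongr
  have hmpos : (0 : ℝ) < (m.factorial : ℝ) ^ 6 := by positivity
  have hIC : ((I : ℝ) ^ 3) ^ 2 < ((C : ℝ) ^ 2) ^ 2 := by
    refine lt_of_mul_lt_mul_left (a := (m.factorial : ℝ) ^ 6) ?_ hmpos.le
    calc _ = (((m.factorial : ℝ) * I) ^ 2) ^ 3 := by ring
      _ < _ := key
      _ = _ := by ring
  have hIC' : I ^ 3 < C ^ 2 := by exact_mod_cast lt_of_pow_lt_pow_left₀ 2 (by positivity) hIC
  rw [pow_succ C 2]
  exact Nat.mul_lt_mul_of_pos_right hIC' (Nat.pos_of_ne_zero fun h0 => by simp [h0] at hIC')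

end IsNeighborhoodDesign

/-! ### Choice of parameters -/

/-- `X` stands for the power of the logarithm lost, so that both bounds share the optimization: `T`
is the largest power of two below `t`, and `q / T` the largest one up to `m / (700X)`. -/
theorem mul_le_of_forall_design {t m r : ℕ} (ht : 2 ≤ t) (hm : 0 < m) {X : ℝ} (hX : 1 ≤ X)
    (htr : t ≤ r) (hmr : m ≤ r)
    (hr : ∀ (V : Type) [Fintype V] [DecidableEq V] (N : V → Finset V) (q T : ℕ),
      IsNeighborhoodDesign N q T → T < t → 2 * m ≤ Fintype.card V →
      Real.log q ≤ Real.log (m * t) → 700 * q * X ≤ m * T → Fintype.card V < r) :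
    1 / 7840000 * ((m : ℝ) ^ 2 * t / X ^ 2) ≤ r := by
  have htr' : (t : ℝ) ≤ r := by exact_mod_cast htr
  have hmr' : (m : ℝ) ≤ r := by exact_mod_cast hmr
  have ht0 : (0 : ℝ) < t := by exact_mod_cast (by omega : 0 < t)
  rcases lt_or_ge (m : ℝ) (700 * X) with hmX | hmX
  · have h1 : (m : ℝ) ^ 2 ≤ (700 * X) ^ 2 := by gcongr
    have h2 : (m : ℝ) ^ 2 * t / X ^ 2 ≤ 490000 * t := by
      rw [div_le_iff₀ (by positivity)]
      nlinarith
    linarith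
  obtain ⟨y, hy⟩ : ∃ y : ℝ, y = m / (700 * X) := ⟨_, rfl⟩
  have hy1 : 1 ≤ y := by rw [hy, one_le_div (by positivity)]; exact hmX
  have hyX : m = 700 * X * y := by rw [hy]; field_simp
  have hyf : ⌊y⌋₊ ≠ 0 := (Nat.floor_pos.2 hy1).ne'
  set a := Nat.log 2 ⌊y⌋₊
  set i := Nat.log 2 (t - 1)
  have ha1 : ((2 ^ a : ℕ) : ℝ) ≤ y :=
    (Nat.cast_le.2 (Nat.pow_log_le_self 2 hyf)).trans (Nat.floor_le (by linarith))
  have ha2 : y < 2 * ((2 ^ a : ℕ) : ℝ) := by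
    have := Nat.lt_pow_succ_log_self one_lt_two ⌊y⌋₊
    have h2 := (Nat.floor_lt (by linarith)).1 this
    rw [pow_succ'] at h2
    exact_mod_cast h2
  have hi1 : 2 ^ i ≤ t - 1 := Nat.pow_log_le_self 2 (by omega)
  have hi2 : t ≤ 2 * 2 ^ i := by
    have := Nat.lt_pow_succ_log_self one_lt_two (t - 1)
    rw [pow_succ'] at this
    change t - 1 < 2 * 2 ^ i at this
    omega
  obtain ⟨V, _, _, N, hN⟩ := exists_isNeighborhoodDesign (Nat.le_add_right i a)
  have hn : Fintype.card V = 2 ^ i * (2 ^ a) ^ 2 := by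
    refine Nat.eq_of_mul_eq_mul_right (Nat.two_pow_pos i) (hN.card_mul.trans ?_)
    rw [pow_add]
    ring
  have hq : ((2 ^ (i + a) : ℕ) : ℝ) = ((2 ^ i : ℕ) : ℝ) * ((2 ^ a : ℕ) : ℝ) := by
    rw [pow_add, Nat.cast_mul]
  have hn' : (Fintype.card V : ℝ) = ((2 ^ i : ℕ) : ℝ) * ((2 ^ a : ℕ) : ℝ) ^ 2 := by
    rw [hn, Nat.cast_mul, Nat.cast_pow (2 ^ a)]
  have hit : ((2 ^ i : ℕ) : ℝ) ≤ t := by exact_mod_cast (by omega : 2 ^ i ≤ t)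
  have hti : (t : ℝ) ≤ 2 * ((2 ^ i : ℕ) : ℝ) := by exact_mod_cast hi2
  have ha0 : (0 : ℝ) < ((2 ^ a : ℕ) : ℝ) := by positivity
  have hi0 : (0 : ℝ) < ((2 ^ i : ℕ) : ℝ) := by positivity
  -- Rounding to powers of two costs `2 ^ 2 * 2 = 8`, and `8 * 700 ^ 2 = 3920000`.
  have hlow : (m : ℝ) ^ 2 * t / X ^ 2 ≤ 3920000 * Fintype.card V := by
    have e : (m : ℝ) ^ 2 * t / X ^ 2 = 490000 * (y ^ 2 * t) := by rw [hyX]; field_simp; ring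
    rw [e, hn']
    have h1 : y ^ 2 * t ≤ (2 * ((2 ^ a : ℕ) : ℝ)) ^ 2 * (2 * ((2 ^ i : ℕ) : ℝ)) := by gcongr
    linarith
  -- If `n < 2m`, the trivial bound `m ≤ r` suffices, at the price of doubling the constant.
  rcases lt_or_ge (Fintype.card V) (2 * m) with hlt | hge
  · have : (Fintype.card V : ℝ) ≤ 2 * m := by exact_mod_cast hlt.le
    linarith
  · have hlt := hr V N _ _ hN (by omega) hge ?_ ?_
    · have : (Fintype.card V : ℝ) ≤ r := by exact_mod_cast hlt.le
      have : (0 : ℝ) ≤ Fintype.card V := by positivity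
      linarith
    · have hym : y ≤ m := by rw [hyX]; nlinarith
      rw [hq, mul_comm (m : ℝ)]
      refine Real.log_le_log (by positivity) ?_
      exact mul_le_mul hit (ha1.trans hym) ha0.le ht0.le
    · rw [hq, hyX]
      calc 700 * (((2 ^ i : ℕ) : ℝ) * ((2 ^ a : ℕ) : ℝ)) * X
          ≤ 700 * (((2 ^ i : ℕ) : ℝ) * y) * X := by gcongr
        _ = _ := by ring

/-- The thresholds on `m` serve only to give `m ≥ 3`, hence `log(mt) ≥ 1`; here `4 log 2 > 2`. -/
theorem three_le_of_log_le {t m : ℕ} (ht : 2 ≤ t) {c : ℝ} (hc : 4 ≤ c)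
    (h : c * Real.log t ≤ m) : 3 ≤ m := by
  have h1 : Real.log 2 ≤ Real.log t := Real.log_le_log two_pos (by exact_mod_cast ht)
  have h2 := Real.log_two_gt_d9
  have : (2 : ℝ) < m := by nlinarith
  exact_mod_cast this

theorem one_le_log_mul {t m : ℕ} (ht : 2 ≤ t) (hm : 3 ≤ m) :
    1 ≤ Real.log ((m : ℝ) * (t : ℝ)) := by
  have h1 : (2 : ℝ) ≤ t := by exact_mod_cast ht
  have h2 : (3 : ℝ) ≤ m := by exact_mod_cast hm
  rw [Real.le_log_iff_exp_le (by positivity)]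
  nlinarith [Real.exp_one_lt_d9]

theorem theorem2 (k : ℕ) (hk : 3 ≤ k) :
    ∃ ρ : ℝ, 0 < ρ ∧ ∀ t : ℕ, 2 ≤ t → ∀ m : ℕ,
      (128 * Real.log (t : ℝ) ^ 2 ≤ (m : ℝ) →
        ρ * ((m : ℝ) ^ 2 * (t : ℝ) / Real.log ((m : ℝ) * (t : ℝ)) ^ 4)
          ≤ (ramseyRep 2 (bipartiteK 2 t) (completeK m) : ℝ)) ∧
      (16 * (k : ℝ) * Real.log (t : ℝ) ≤ (m : ℝ) →
        ρ * ((m : ℝ) ^ 2 * (t : ℝ) / Real.log ((m : ℝ) * (t : ℝ)) ^ 2)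
          ≤ (ramseyRep k (bipartiteK 2 t) (completeK m) : ℝ)) := by
  refine ⟨1 / 7840000, by norm_num, fun t ht m => ⟨fun h => ?_, fun h => ?_⟩⟩
  · have hlog : Real.log 2 ≤ Real.log t := Real.log_le_log two_pos (by exact_mod_cast ht)
    have hm : 3 ≤ m := three_le_of_log_le ht (c := 128 * Real.log t)
      (by linarith [Real.log_two_gt_d9]) (by rwa [mul_assoc, ← sq])
    have hl := one_le_log_mul ht hm
    have e : Real.log ((m : ℝ) * t) ^ 4 = (Real.log ((m : ℝ) * t) ^ 2) ^ 2 := by ring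
    rw [e]
    refine mul_le_of_forall_design ht (by omega) (one_le_pow₀ hl)
      (by have := lt_ramseyRep_bipartiteK 2 t m two_pos (by omega); omega)
      (le_ramseyRep_bipartiteK 2 t m (by omega)) ?_
    intro V _ _ N q T hN hTt hmV hq hmT
    exact hN.card_lt_ramseyRep_two hTt hmV (by omega) hl hq hmT
  · have hk' : (3 : ℝ) ≤ k := by exact_mod_cast hk
    have hm : 3 ≤ m := three_le_of_log_le ht (by linarith) h
    have hl := one_le_log_mul ht hm
    refine mul_le_of_forall_design ht (by omega) hl
      (by have := lt_ramseyRep_bipartiteK k t m (by omega) (by omega); omega)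
      (le_ramseyRep_bipartiteK k t m (by omega)) ?_
    intro V _ _ N q T hN hTt hmV hq hmT
    exact hN.card_lt_ramseyRep_of_three_le hk hTt hmV (by omega) hl hq hmT
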